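/- Let $\nu$ be a probability law on $\mathbb{R}$ with distribution function $F$, supported on $[1,\infty)$ (that is, $F(x)=0$ for $x<1$), and let $\overline F = 1-F$. For $s\in(0,1)$ let $F^{\leftarrow}(s)=\inf\{x>0 : F(x)\ge s\}$ be the generalized inverse. Let $\alpha>0$ and suppose that $$\lim_{t\to\infty}\frac{\overline F(tx)}{\overline F(t)}=x^{-\alpha}\quad\text{for every }x>0,$$ that $\overline F$ is continuous, and that $F^{\leftarrow}$ is continuous on $(0,1)$. Let $X_1,X_2,\dots$ be independent random variables with common distribution function $F$, and for $n\ge 2$ let $X_{1:n}\le\dots\le X_{n:n}$ be the order statistics of $X_1,\dots,X_n$. For $1\le k\le n-1$ define Hill's estimator and the Kolmogorov–Smirnov distance between the empirical law of the $k$ largest normalized order statistics and the fitted Pareto law by $$\widehat\alpha_{n,k}=\Big(\frac1k\sum_{i=1}^k\log\frac{X_{n-k+i:n}}{X_{n-k:n}}\Big)^{-1},\qquad D_{n,k}=\sup_{y\ge1}\Big|\frac1k\sum_{i=1}^k\mathbf 1_{(y,\infty)}\Big(\frac{X_{n-k+i:n}}{X_{n-k:n}}\Big)-y^{-\widehat\alpha_{n,k}}\Big|,$$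 and let $\kappa_n^\star$ be the smallest minimizer of $k\mapsto D_{n,k}$ over $1\le k\le n-1$. Then the PLFit estimator $\widehat\alpha_{n,\kappa_n^\star}$ is consistent: $\widehat\alpha_{n,\kappa_n^\star}\to\alpha$ in probability as $n\to\infty$. (No distinction is made between laws for which $\overline F(x)=cx^{-\alpha}$ for some $c>0$ and all large $x$ and other laws; both are covered.) -/

import Mathlib

open MeasureTheory ProbabilityTheory Filter Topology

noncomputable section

namespace PLFit

/-- `f` is regularly varying at infinity with index `ρ`:
`f (t * x) / f t → x ^ ρ` as `t → ∞`, for every `x > 0`. -/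
def RegularlyVarying (f : ℝ → ℝ) (ρ : ℝ) : Prop :=
  ∀ x : ℝ, 0 < x → Tendsto (fun t : ℝ => f (t * x) / f t) atTop (𝓝 (x ^ ρ))

/-- The tail `1 - F` of a distribution function `F`. -/
def tail (F : ℝ → ℝ) (x : ℝ) : ℝ := 1 - F x

/-- The generalized inverse `s ↦ inf {x > 0 : F x ≥ s}` of a distribution function `F`
of a positive random variable (used for `0 < s < 1`, where the set is non-empty and bounded
below). -/
def genInverse (F : ℝ → ℝ) (s : ℝ) : ℝ := sInf {x : ℝ | 0 < x ∧ s ≤ F x}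

/-- The `j`-th smallest value (`1 ≤ j ≤ n`) in the sample `x`, i.e. the order statistic `X_{j:n}`.
The value is `0` for `j` outside this range. -/
def orderStat {n : ℕ} (x : Fin n → ℝ) (j : ℕ) : ℝ :=
  if h : 1 ≤ j ∧ j ≤ n then x (Tuple.sort x ⟨j - 1, by omega⟩) else 0

/-- The normalized order statistic `X_{n-k+i:n} / X_{n-k:n}` (for `1 ≤ i ≤ k ≤ n - 1`). -/
def normOrderStat {n : ℕ} (x : Fin n → ℝ) (k i : ℕ) : ℝ :=
  orderStat x (n - k + i) / orderStat x (n - k)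

/-- Hill's statistic `H_{n,k}`: the mean log-excess of the `k` largest observations. -/
def hillStat {n : ℕ} (x : Fin n → ℝ) (k : ℕ) : ℝ :=
  (1 / (k : ℝ)) * ∑ i ∈ Finset.Icc 1 k, Real.log (normOrderStat x k i)

/-- Hill's estimator of the tail index, `H_{n,k}⁻¹`. -/
def hillEstimator {n : ℕ} (x : Fin n → ℝ) (k : ℕ) : ℝ := (hillStat x k)⁻¹

/-- The Kolmogorov-Smirnov distance `D_{n,k}` between the empirical distribution of the `k` largest
normalized order statistics and the Pareto law on `[1, ∞)` whose index is Hill's estimator. -/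
def ksDist {n : ℕ} (x : Fin n → ℝ) (k : ℕ) : ℝ :=
  ⨆ y : Set.Ici (1 : ℝ),
    |(1 / (k : ℝ)) * ∑ i ∈ Finset.Icc 1 k,
        Set.indicator (Set.Ioi (y : ℝ)) (fun _ => (1 : ℝ)) (normOrderStat x k i)
      - (y : ℝ) ^ (-hillEstimator x k)|

/-- The smallest minimizer of `k ↦ D_{n,k}` over `1 ≤ k ≤ n - 1` (which exists if `2 ≤ n`). -/
def kappaStar {n : ℕ} (x : Fin n → ℝ) : ℕ :=
  sInf {k : ℕ | k ∈ Finset.Icc 1 (n - 1) ∧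
    ∀ j ∈ Finset.Icc 1 (n - 1), ksDist x k ≤ ksDist x j}

/-- The PLFit estimator: Hill's estimator at the data-driven number of order statistics. -/
def plfit {n : ℕ} (x : Fin n → ℝ) : ℝ := hillEstimator x (kappaStar x)

end PLFit

end

/-! Write M(u) for the number of observations above u and p for the tail of ν. With t = X_{n-k:n},
the distance D_{n,k} compares the curves y ↦ M(ty)/k and y ↦ y^{-a}, where a is Hill's estimate.
Consistency rests on four facts.

The minimum of D tends to 0 in probability. By regular variation and Karamata's theorem, a fixed
high threshold T has conditional law and mean log-excess close to the Pareto ones. The choice k =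
M(T), together with the law of large numbers at finitely many levels, then makes D small
(`tendsto_measure_not_exists_ksDist_le`).

The minimizer is large, since D_{n,k} ≥ 1/(2k) for every sample (`one_le_two_mul_ksDist`).

M(u) is within a small relative error of n p(u), plus a constant independent of n, for all u
simultaneously and with high probability (`exists_measure_exceedances_deviation_le`). For large k
that constant is negligible, so M(ty)/k is uniformly close to p(ty)/p(t), even at the random t.

Hence at the minimizer p(t·)/p(t) is uniformly close to a Pareto tail of index a, and this alone
forces a to be near α, whatever t ≥ 1 is (`exists_abs_sub_lt_of_close`). The threshold need not go
to infinity: if it stays bounded, p is nearly Pareto from a bounded point on, and its index can only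
be α. This is why exact Pareto tails need no separate treatment. -/

namespace PLFit

/-! ### Order statistics and exceedance counts -/

/-- The number of sample points exceeding `u`, as a real number. -/
noncomputable def exceedances {n : ℕ} (x : Fin n → ℝ) (u : ℝ) : ℝ :=
  ∑ i, (Set.Ioi u).indicator (fun _ => (1 : ℝ)) (x i)

lemma orderStat_succ {n : ℕ} (x : Fin n → ℝ) (j : Fin n) :
    orderStat x (j + 1) = x (Tuple.sort x j) := by
  have : 1 ≤ (j : ℕ) + 1 ∧ (j : ℕ) + 1 ≤ n := by omega
  simp [orderStat, this]

lemma orderStat_mono {n : ℕ} (x : Fin n → ℝ) {i j : ℕ} (hi : 1 ≤ i) (hij : i ≤ j) (hj : j ≤ n) :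
    orderStat x i ≤ orderStat x j := by
  have h1 := orderStat_succ x ⟨i - 1, by omega⟩
  have h2 := orderStat_succ x ⟨j - 1, by omega⟩
  simp only [Nat.sub_add_cancel hi, Nat.sub_add_cancel (hi.trans hij)] at h1 h2
  rw [h1, h2]
  exact Tuple.monotone_sort x (by simp only [Fin.mk_le_mk]; omega)

lemma orderStat_mem {n : ℕ} (x : Fin n → ℝ) {j : ℕ} (hj : 1 ≤ j) (hjn : j ≤ n) :
    ∃ i, orderStat x j = x i :=
  ⟨_, by simpa [Nat.sub_add_cancel hj] using orderStat_succ x ⟨j - 1, by omega⟩⟩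

lemma sum_eq_sum_orderStat {n : ℕ} (x : Fin n → ℝ) (f : ℝ → ℝ) :
    ∑ i, f (x i) = ∑ j ∈ Finset.range n, f (orderStat x (j + 1)) := by
  rw [Finset.sum_range, ← Equiv.sum_comp (Tuple.sort x)]
  simp only [orderStat_succ]

/-- This removes the sorting: statistics of the k largest values become plain sums over the sample,
to which laws of large numbers apply. Ties at the threshold are harmless because f vanishes there.
-/
lemma sum_orderStat_upper {n : ℕ} (x : Fin n → ℝ) {k : ℕ} (hk : k < n) (f : ℝ → ℝ)
    (hf : ∀ z ≤ orderStat x (n - k), f z = 0) :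
    ∑ i ∈ Finset.Icc 1 k, f (orderStat x (n - k + i)) = ∑ i, f (x i) := by
  rw [sum_eq_sum_orderStat,
    show Finset.range n = Finset.range (n - k + k) by rw [Nat.sub_add_cancel hk.le],
    Finset.sum_range_add, Finset.sum_eq_zero (s := Finset.range (n - k)), zero_add, ← Finset.Ico_add_one_right_eq_Icc,
    Finset.sum_Ico_eq_sum_range]
  · simp only [Nat.add_sub_cancel]
    exact Finset.sum_congr rfl fun i _ => by congr 2; omega
  · intro j hj
    rw [Finset.mem_range] at hj
    exact hf _ (orderStat_mono x (by omega) (by omega) (by omega))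

lemma exceedances_nonneg {n : ℕ} (x : Fin n → ℝ) (u : ℝ) : 0 ≤ exceedances x u :=
  Finset.sum_nonneg fun _ _ => Set.indicator_nonneg (fun _ _ => zero_le_one) _

lemma exceedances_le {n : ℕ} (x : Fin n → ℝ) (u : ℝ) : exceedances x u ≤ n := by
  calc exceedances x u ≤ ∑ _i : Fin n, (1 : ℝ) :=
        Finset.sum_le_sum fun i _ => Set.indicator_le_self' (fun _ _ => zero_le_one) _
    _ = n := by simp

lemma exceedances_antitone {n : ℕ} (x : Fin n → ℝ) : Antitone (exceedances x) := fun _ _ h =>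
  Finset.sum_le_sum fun _ _ =>
    Set.indicator_le_indicator_of_subset (Set.Ioi_subset_Ioi h) (fun _ => zero_le_one) _

lemma exists_nat_exceedances {n : ℕ} (x : Fin n → ℝ) (u : ℝ) : ∃ k : ℕ, exceedances x u = k := by
  classical
  refine ⟨(Finset.univ.filter fun i => u < x i).card, ?_⟩
  simp [exceedances, Set.indicator_apply]

lemma exceedances_orderStat_le {n : ℕ} (x : Fin n → ℝ) {k : ℕ} (hk : k < n) :
    exceedances x (orderStat x (n - k)) ≤ k := by
  rw [exceedances, ← sum_orderStat_upper x hk]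
  · calc _ ≤ ∑ _i ∈ Finset.Icc 1 k, (1 : ℝ) :=
        Finset.sum_le_sum fun i _ => Set.indicator_le_self' (fun _ _ => zero_le_one) _
      _ = k := by simp
  · intro z hz
    simp [hz]

/-- Below the threshold strictly, X_{n-k:n} itself is counted along with the k values above it,
whence k + 1. -/
lemma succ_le_exceedances {n : ℕ} (x : Fin n → ℝ) {k : ℕ} (hk : k < n) {u : ℝ}
    (hu : u < orderStat x (n - k)) : (k : ℝ) + 1 ≤ exceedances x u := by
  rw [exceedances, sum_eq_sum_orderStat]
  calc (k : ℝ) + 1 = ∑ j ∈ Finset.Ico (n - k - 1) n, (1 : ℝ) := by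
        simp only [Finset.sum_const, Nat.card_Ico, nsmul_eq_mul, mul_one]
        rw [show n - (n - k - 1) = k + 1 by omega]; push_cast; ring
    _ ≤ ∑ j ∈ Finset.Ico (n - k - 1) n,
          (Set.Ioi u).indicator (fun _ => (1 : ℝ)) (orderStat x (j + 1)) := by
        refine Finset.sum_le_sum fun j hj => ?_
        rw [Finset.mem_Ico] at hj
        rw [Set.indicator_of_mem]
        exact hu.trans_le (orderStat_mono x (by omega) (by omega) (by omega))
    _ ≤ _ := by
        refine Finset.sum_le_sum_of_subset_of_nonneg (fun j hj => ?_) fun _ _ _ =>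
          Set.indicator_nonneg (fun _ _ => zero_le_one) _
        rw [Finset.mem_Ico] at hj
        exact Finset.mem_range.2 hj.2

lemma orderStat_le_of_exceedances_le {n : ℕ} (x : Fin n → ℝ) {k : ℕ} (hk : k < n) {u : ℝ}
    (hu : exceedances x u ≤ k) : orderStat x (n - k) ≤ u := by
  by_contra! h
  linarith [succ_le_exceedances x hk h]

lemma lt_orderStat_of_lt_exceedances {n : ℕ} (x : Fin n → ℝ) {k : ℕ} (hk : k < n) {u : ℝ}
    (hu : k < exceedances x u) : u < orderStat x (n - k) := by
  by_contra! h
  linarith [exceedances_antitone x h, exceedances_orderStat_le x hk]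

lemma sum_indicator_normOrderStat {n : ℕ} (x : Fin n → ℝ) {k : ℕ} (hk : k < n)
    (ht : 0 < orderStat x (n - k)) {y : ℝ} (hy : 1 ≤ y) :
    ∑ i ∈ Finset.Icc 1 k, (Set.Ioi y).indicator (fun _ => (1 : ℝ)) (normOrderStat x k i) =
      exceedances x (orderStat x (n - k) * y) := by
  rw [exceedances, ← sum_orderStat_upper x hk]
  · refine Finset.sum_congr rfl fun i _ => ?_
    simp only [Set.indicator_apply, Set.mem_Ioi, normOrderStat, lt_div_iff₀ ht, mul_comm y]
  · intro z hz
    have : z ≤ orderStat x (n - k) * y := hz.trans (le_mul_of_one_le_right ht.le hy)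
    simp [this]

/-- The positive part makes the summand vanish below the threshold and decrease in the threshold, so
a random threshold can later be sandwiched between fixed ones. -/
lemma hillStat_eq {n : ℕ} (x : Fin n → ℝ) {k : ℕ} (hk : k < n) (hx : ∀ i, 0 < x i) :
    hillStat x k =
      (1 / (k : ℝ)) * ∑ i, max (Real.log (x i / orderStat x (n - k))) 0 := by
  have ht : 0 < orderStat x (n - k) := by
    obtain ⟨i, hi⟩ := orderStat_mem x (j := n - k) (by omega) (by omega)
    exact hi ▸ hx i
  have key : ∑ i ∈ Finset.Icc 1 k, Real.log (normOrderStat x k i) =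
      ∑ i ∈ Finset.Icc 1 k, max (Real.log (orderStat x (n - k + i) / orderStat x (n - k))) 0 := by
    refine Finset.sum_congr rfl fun i hi => ?_
    rw [Finset.mem_Icc] at hi
    rw [normOrderStat, max_eq_left]
    refine Real.log_nonneg ((one_le_div ht).2 ?_)
    exact orderStat_mono x (by omega) (by omega) (by omega)
  rw [hillStat, key]
  -- The explicit cutoff is needed because `Real.log` is even: without it the function would not
  -- vanish at very negative z.
  have h0 : ∀ i, max (Real.log (x i / orderStat x (n - k))) 0 =
      (fun z => if z ≤ orderStat x (n - k) then 0 else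
        max (Real.log (z / orderStat x (n - k))) 0) (x i) := by
    intro i
    by_cases h : x i ≤ orderStat x (n - k)
    · simp only [h, if_true]
      exact max_eq_right
        (Real.log_nonpos (div_nonneg (hx i).le ht.le) ((div_le_one ht).2 h))
    · simp [h]
  rw [Finset.sum_congr rfl fun i _ => h0 i]
  rw [← sum_orderStat_upper x hk (fun z => if z ≤ orderStat x (n - k) then 0 else
    max (Real.log (z / orderStat x (n - k))) 0) (fun z hz => by simp [hz])]
  congr 1
  refine Finset.sum_congr rfl fun i hi => ?_
  rw [Finset.mem_Icc] at hi
  by_cases h : orderStat x (n - k + i) ≤ orderStat x (n - k)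
  · have h' : orderStat x (n - k + i) = orderStat x (n - k) :=
      le_antisymm h (orderStat_mono x (by omega) (by omega) (by omega))
    simp [h', ht.ne']
  · simp [h]

lemma hillEstimator_nonneg {n : ℕ} (x : Fin n → ℝ) {k : ℕ} (hk : k < n) (hx : ∀ i, 0 < x i) :
    0 ≤ hillEstimator x k := by
  rw [hillEstimator, hillStat_eq x hk hx]
  exact inv_nonneg.2 (mul_nonneg (by positivity) (Finset.sum_nonneg fun _ _ => le_max_right _ _))

lemma orderStat_pos {n : ℕ} (x : Fin n → ℝ) {k : ℕ} (hk : k < n) (hx : ∀ i, 0 < x i) :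
    0 < orderStat x (n - k) := by
  obtain ⟨i, hi⟩ := orderStat_mem x (j := n - k) (by omega) (by omega)
  exact hi ▸ hx i

lemma ksDist_eq {n : ℕ} (x : Fin n → ℝ) {k : ℕ} (hk : k < n) (hx : ∀ i, 0 < x i) :
    ksDist x k = ⨆ y : Set.Ici (1 : ℝ),
      |exceedances x (orderStat x (n - k) * y) / k - (y : ℝ) ^ (-hillEstimator x k)| := by
  rw [ksDist]
  congr 1
  ext y
  rw [sum_indicator_normOrderStat x hk (orderStat_pos x hk hx) y.2, one_div_mul_eq_div]

/-- A real supremum dominates its terms only if it is bounded; here both curves take values in [0,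
1]. -/
lemma le_ksDist {n : ℕ} (x : Fin n → ℝ) {k : ℕ} (hk : k < n) (hx : ∀ i, 0 < x i) {y : ℝ}
    (hy : 1 ≤ y) :
    |exceedances x (orderStat x (n - k) * y) / k - y ^ (-hillEstimator x k)| ≤ ksDist x k := by
  rw [ksDist_eq x hk hx]
  refine le_ciSup (f := fun y : Set.Ici (1 : ℝ) =>
      |exceedances x (orderStat x (n - k) * y) / k - (y : ℝ) ^ (-hillEstimator x k)|)
    ⟨1, ?_⟩ ⟨y, hy⟩
  rintro _ ⟨⟨z, hz⟩, rfl⟩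
  have hz' : (1 : ℝ) ≤ z := hz
  have h1 : exceedances x (orderStat x (n - k) * z) ≤ k :=
    (exceedances_antitone x (le_mul_of_one_le_right (orderStat_pos x hk hx).le hz')).trans
      (exceedances_orderStat_le x hk)
  have h2 := exceedances_nonneg x (orderStat x (n - k) * z)
  have h3 : z ^ (-hillEstimator x k) ≤ 1 := Real.rpow_le_one_of_one_le_of_nonpos hz'
    (neg_nonpos.2 (hillEstimator_nonneg x hk hx))
  have h4 : 0 ≤ z ^ (-hillEstimator x k) := Real.rpow_nonneg (by linarith) _
  have h5 := div_le_one_of_le₀ h1 (Nat.cast_nonneg k)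
  have h6 := div_nonneg h2 (Nat.cast_nonneg k)
  rw [abs_le]
  constructor <;> simp only <;> linarith

lemma ksDist_le {n : ℕ} (x : Fin n → ℝ) {k : ℕ} (hk : k < n) (hx : ∀ i, 0 < x i) {η : ℝ}
    (h : ∀ y : ℝ, 1 ≤ y →
      |exceedances x (orderStat x (n - k) * y) / k - y ^ (-hillEstimator x k)| ≤ η) :
    ksDist x k ≤ η := by
  rw [ksDist_eq x hk hx]
  have : Nonempty (Set.Ici (1 : ℝ)) := ⟨⟨1, Set.self_mem_Ici⟩⟩
  exact ciSup_le fun y => h y y.2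

/-- An empirical law with `k` atoms is at distance at least `1 / (2 k)` of a continuous law. -/
lemma one_le_two_mul_ksDist {n : ℕ} (x : Fin n → ℝ) {k : ℕ} (hk1 : 1 ≤ k) (hk : k < n)
    (hx : ∀ i, 0 < x i) : 1 ≤ 2 * k * ksDist x k := by
  have hk0 : (0 : ℝ) < k := by exact_mod_cast hk1
  have ht := orderStat_pos x hk hx
  set t := orderStat x (n - k) with htdef
  have hmt : t ≤ orderStat x (n - 0) := orderStat_mono x (by omega) (by omega) (by omega)
  set m := orderStat x (n - 0)
  set a := hillEstimator x k
  -- At the normalized maximum y₀ the empirical tail jumps from at least 1/k to 0, while the Pareto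
  -- tail is continuous; one side of the jump is missed by at least 1/(2k).
  set y₀ := m / t
  have hy₀ : 1 ≤ y₀ := (one_le_div ht).2 hmt
  have hm : t * y₀ = m := by simp only [y₀]; field_simp
  have e0 : exceedances x m = 0 := le_antisymm
    ((exceedances_orderStat_le x (k := 0) (by omega)).trans_eq Nat.cast_zero) (exceedances_nonneg _ _)
  have h1 : y₀ ^ (-a) ≤ ksDist x k := by
    have := le_ksDist x hk hx hy₀
    rw [← htdef, hm, e0, zero_div, zero_sub, abs_neg] at this
    exact (le_abs_self _).trans this
  rcases hy₀.eq_or_lt with h | h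
  -- If the threshold ties with the maximum, the empirical tail is 0 at y = 1, where the Pareto tail
  -- is 1.
  · rw [← h, Real.one_rpow] at h1
    have : (1 : ℝ) ≤ k := by exact_mod_cast hk1
    nlinarith
  · have h2 : ∀ y ∈ Set.Ioo 1 y₀, 1 / (k : ℝ) - ksDist x k ≤ y ^ (-a) := by
      intro y hy
      have h3 := le_ksDist x hk hx hy.1.le
      have h4 : (((0 : ℕ) : ℝ)) + 1 ≤ exceedances x (t * y) := by
        refine succ_le_exceedances x (k := 0) (by omega) ?_
        calc t * y < t * y₀ := by gcongr; exact hy.2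
          _ = m := hm
      rw [← htdef] at h3
      have h5 : 1 / (k : ℝ) ≤ exceedances x (t * y) / k := by
        gcongr; simpa using h4
      linarith [(abs_le.1 h3).2]
    have h3 : 1 / (k : ℝ) - ksDist x k ≤ y₀ ^ (-a) := by
      have hc : Tendsto (fun y : ℝ => y ^ (-a)) (𝓝[<] y₀) (𝓝 (y₀ ^ (-a))) :=
        (Real.continuousAt_rpow_const _ _ (Or.inl (by linarith))).tendsto.mono_left
          nhdsWithin_le_nhds
      refine ge_of_tendsto hc ?_
      filter_upwards [Ioo_mem_nhdsLT h] with y hy using h2 y hy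
    have h6 : 1 / (k : ℝ) ≤ 2 * ksDist x k := by linarith
    rw [div_le_iff₀ hk0] at h6
    linarith

lemma kappaStar_spec {n : ℕ} (x : Fin n → ℝ) (hn : 2 ≤ n) :
    1 ≤ kappaStar x ∧ kappaStar x < n ∧
      ∀ j, 1 ≤ j → j < n → ksDist x (kappaStar x) ≤ ksDist x j := by
  obtain ⟨k, hk, hmin⟩ := Finset.exists_min_image (Finset.Icc 1 (n - 1)) (ksDist x)
    ⟨1, by simp; omega⟩
  have h := Nat.sInf_mem (s := {k : ℕ | k ∈ Finset.Icc 1 (n - 1) ∧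
    ∀ j ∈ Finset.Icc 1 (n - 1), ksDist x k ≤ ksDist x j}) ⟨k, hk, hmin⟩
  obtain ⟨h1, h2⟩ := h
  rw [Finset.mem_Icc] at h1
  refine ⟨h1.1, ?_, fun j hj1 hj => h2 j (by rw [Finset.mem_Icc]; omega)⟩
  have := h1.2
  change sInf _ < n
  omega

/-! ### Uniform approximation of a Pareto tail by monotone functions -/

/-- A finite grid controls the distance of antitone functions to a Pareto tail. -/
lemma exists_grid_rpow_neg {α : ℝ} (hα : 0 < α) {η : ℝ} (hη : 0 < η) :
    ∃ (G : Finset ℝ) (c : ℝ), 0 < c ∧ (∀ y ∈ G, 1 ≤ y) ∧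
      ∀ g : ℝ → ℝ, AntitoneOn g (Set.Ici 1) → (∀ y, 1 ≤ y → 0 ≤ g y) →
        (∀ y ∈ G, |g y - y ^ (-α)| ≤ c) → ∀ y, 1 ≤ y → |g y - y ^ (-α)| ≤ η := by
  obtain ⟨m, hm⟩ := exists_nat_gt (2 / η)
  have hm0 : (0 : ℝ) < m := lt_trans (by positivity) hm
  have hmη : 2 / (m : ℝ) ≤ η := by
    rw [div_lt_iff₀ hη] at hm
    rw [div_le_iff₀ hm0]; linarith
  -- Pareto quantiles: the tail equals j/m at `z j`. Monotonicity between neighbours costs 1/m and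
  -- the tolerance on the grid another 1/m.
  let z : ℕ → ℝ := fun j => ((j : ℝ) / m) ^ (-α⁻¹)
  have hz1 : ∀ j ∈ Finset.Icc 1 m, 1 ≤ z j := by
    intro j hj
    rw [Finset.mem_Icc] at hj
    have hj1 : (1 : ℝ) ≤ j := by exact_mod_cast hj.1
    have hj2 : (j : ℝ) ≤ m := by exact_mod_cast hj.2
    exact Real.one_le_rpow_of_pos_of_le_one_of_nonpos (by positivity)
      ((div_le_one hm0).2 hj2) (by simp [hα.le])
  have hzα : ∀ j, z j ^ (-α) = (j : ℝ) / m := by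
    intro j
    simp only [z]
    rw [← Real.rpow_mul (by positivity), neg_mul_neg, inv_mul_cancel₀ hα.ne', Real.rpow_one]
  have hinv : ∀ y : ℝ, 1 ≤ y → (y ^ (-α)) ^ (-α⁻¹) = y := by
    intro y hy
    rw [← Real.rpow_mul (by linarith), neg_mul_neg, mul_inv_cancel₀ hα.ne', Real.rpow_one]
  refine ⟨(Finset.Icc 1 m).image z, 1 / m, by positivity, ?_, ?_⟩
  · intro y hy
    obtain ⟨j, hj, rfl⟩ := Finset.mem_image.1 hy
    exact hz1 j hj
  intro g hg hg0 hG y hy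
  have hG' : ∀ j ∈ Finset.Icc 1 m, |g (z j) - (j : ℝ) / m| ≤ 1 / m := by
    intro j hj
    have := hG _ (Finset.mem_image_of_mem z hj)
    rwa [hzα] at this
  set v := y ^ (-α) with hv
  have hv0 : 0 < v := Real.rpow_pos_of_pos (by linarith) _
  have hv1 : v ≤ 1 := Real.rpow_le_one_of_one_le_of_nonpos hy (by linarith)
  set j := ⌈v * m⌉₊
  have hj1 : 1 ≤ j := Nat.one_le_ceil_iff.2 (by positivity)
  have hjm : j ≤ m := Nat.ceil_le.2 (by nlinarith)
  have hvj : v ≤ (j : ℝ) / m := by rw [le_div_iff₀ hm0]; exact Nat.le_ceil _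
  have hjv : ((j : ℝ) - 1) / m < v := by
    rw [div_lt_iff₀ hm0]
    linarith [Nat.ceil_lt_add_one (show 0 ≤ v * m by positivity)]
  have hsplit : ((j : ℝ) - 1) / m = (j : ℝ) / m - 1 / m := by ring
  have h2m : 2 / (m : ℝ) = 1 / m + 1 / m := by ring
  have hup : g y ≤ (j : ℝ) / m + 1 / m := by
    have h1 : z j ≤ y := by
      conv_rhs => rw [← hinv y hy]
      exact Real.rpow_le_rpow_of_nonpos hv0 hvj (by simp [hα.le])
    have hjmem : j ∈ Finset.Icc 1 m := Finset.mem_Icc.2 ⟨hj1, hjm⟩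
    have h2 := hg (hz1 j hjmem) hy h1
    linarith [(abs_le.1 (hG' j hjmem)).2]
  have hlow : ((j : ℝ) - 1) / m - 1 / m ≤ g y := by
    -- For j = 1 there is no grid point to the right of y, and nonnegativity of g replaces it.
    rcases hj1.eq_or_lt with h | h
    · rw [← h]
      have := hg0 y hy
      have : 0 < 1 / (m : ℝ) := by positivity
      have h1 : (((1 : ℕ) : ℝ) - 1) / m = 0 := by simp
      linarith
    · have hjmem : j - 1 ∈ Finset.Icc 1 m := Finset.mem_Icc.2 ⟨by omega, by omega⟩
      have hc : ((j - 1 : ℕ) : ℝ) = (j : ℝ) - 1 := by push_cast [hj1]; ring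
      have hj0 : (0 : ℝ) < (j : ℝ) - 1 := by
        have : (1 : ℝ) < j := by exact_mod_cast h
        linarith
      have h1 : y ≤ z (j - 1) := by
        conv_lhs => rw [← hinv y hy]
        refine Real.rpow_le_rpow_of_nonpos ?_ ?_ (by simp [hα.le])
        · rw [hc]; positivity
        · rw [hc]; exact hjv.le
      have h2 := hg hy (hz1 _ hjmem) h1
      have h3 := (abs_le.1 (hG' _ hjmem)).1
      rw [hc] at h3
      linarith
  rw [abs_le]
  constructor <;> linarith

lemma antitoneOn_rpow_neg {a : ℝ} (ha : 0 ≤ a) :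
    AntitoneOn (fun y : ℝ => y ^ (-a)) (Set.Ici 1) := by
  intro y hy z _ hyz
  have hy' : (1 : ℝ) ≤ y := hy
  exact Real.rpow_le_rpow_of_nonpos (by linarith) hyz (by linarith)

/-- The Pareto tail depends on its index continuously, uniformly in the argument. -/
lemma eventually_abs_rpow_neg_sub_le {α : ℝ} (hα : 0 < α) {η : ℝ} (hη : 0 < η) :
    ∀ᶠ a in 𝓝 α, ∀ y : ℝ, 1 ≤ y → |y ^ (-a) - y ^ (-α)| ≤ η := by
  obtain ⟨G, c, hc, hG1, hG⟩ := exists_grid_rpow_neg hα hη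
  have h1 : ∀ᶠ a in 𝓝 α, ∀ y ∈ G, |y ^ (-a) - y ^ (-α)| ≤ c := by
    rw [Filter.eventually_all_finset]
    intro y hy
    have hy0 : (0 : ℝ) < y := by linarith [hG1 y hy]
    have : ContinuousAt (fun a : ℝ => y ^ (-a)) α := by
      have := (Real.continuous_const_rpow hy0.ne').comp continuous_neg
      exact this.continuousAt
    filter_upwards [Metric.tendsto_nhds.1 this c hc] with a ha
    exact (Real.dist_eq _ _ ▸ ha).le
  filter_upwards [h1, lt_mem_nhds hα] with a ha ha0
  exact hG _ (antitoneOn_rpow_neg ha0.le) (fun y hy => Real.rpow_nonneg (by linarith) _) ha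

/-! ### Regularly varying tails -/

/-- If a continuous regularly varying tail is close to a Pareto law beyond some threshold, then the
index of that Pareto law is close to the tail index. -/
lemma exists_abs_sub_lt_of_close {p : ℝ → ℝ} {α : ℝ}
    (hp : ∀ x, 0 < p x) (hcont : Continuous p)
    (hRV : RegularlyVarying p (-α)) {ε : ℝ} (hε : 0 < ε) :
    ∃ η > 0, ∀ t a : ℝ, 1 ≤ t → (∀ y, 1 ≤ y → |p (t * y) / p t - y ^ (-a)| ≤ η) →
      |a - α| < ε := by
  by_contra! hcon
  have hpos : ∀ m : ℕ, (0 : ℝ) < 1 / ((m : ℝ) + 1) := fun m => by positivity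
  choose t a ht hclose hfar using fun m : ℕ => hcon (1 / ((m : ℝ) + 1)) (hpos m)
  -- convergence of the ratios at `2` along a subsequence forces convergence of `a`
  have key : ∀ (φ : ℕ → ℕ) (r : ℝ → ℝ), StrictMono φ → 0 < r 2 →
      (∀ y, 1 ≤ y → Tendsto (fun m => p (t (φ m) * y) / p (t (φ m))) atTop (𝓝 (r y))) →
      ∃ b, Tendsto (a ∘ φ) atTop (𝓝 b) ∧ ∀ y, 1 ≤ y → r y = y ^ (-b) := by
    intro φ r hφ hr2 hr
    have hpow : ∀ y, 1 ≤ y → Tendsto (fun m => y ^ (-a (φ m))) atTop (𝓝 (r y)) := by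
      intro y hy
      have h0 : Tendsto (fun m => p (t (φ m) * y) / p (t (φ m)) - y ^ (-a (φ m))) atTop (𝓝 0) := by
        refine squeeze_zero_norm (fun m => hclose (φ m) y hy) ?_
        exact tendsto_one_div_add_atTop_nhds_zero_nat.comp hφ.tendsto_atTop
      simpa using (hr y hy).sub h0
    -- The single value at y = 2 determines the exponent.
    have hlog := (hpow 2 (by norm_num)).log hr2.ne'
    have hl2 : Real.log 2 ≠ 0 := (Real.log_pos (by norm_num)).ne'
    have hb : Tendsto (a ∘ φ) atTop (𝓝 (-(Real.log (r 2) / Real.log 2))) := by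
      refine ((hlog.div_const (Real.log 2)).neg).congr fun m => ?_
      rw [Real.log_rpow (by norm_num)]
      simp only [Function.comp_apply]
      field_simp
    refine ⟨_, hb, fun y hy => ?_⟩
    have hc : Continuous fun s : ℝ => y ^ (-s) :=
      (Real.continuous_const_rpow (by linarith : y ≠ 0)).comp continuous_neg
    exact tendsto_nhds_unique (hpow y hy) ((hc.tendsto _).comp hb)
  have hne : ∀ φ : ℕ → ℕ, ¬ Tendsto (a ∘ φ) atTop (𝓝 α) := by
    intro φ h
    obtain ⟨m, hm⟩ := (Metric.tendsto_nhds.1 h ε hε).exists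
    exact absurd (hfar (φ m)) (not_le.2 (by simpa [Real.dist_eq] using hm))
  by_cases hbdd : BddAbove (Set.range t)
  -- Bounded thresholds: at a limit point s, p is exactly Pareto beyond s, and regular variation at
  -- infinity identifies its index.
  · obtain ⟨T, hT⟩ := hbdd
    obtain ⟨s, hs, φ, hφ, hts⟩ := (isCompact_Icc (a := (1 : ℝ)) (b := T)).tendsto_subseq
      (fun m => ⟨ht m, hT ⟨m, rfl⟩⟩)
    have hs0 : 0 < s := by linarith [hs.1]
    obtain ⟨b, hb, hr⟩ := key φ (fun y => p (s * y) / p s) hφ (div_pos (hp _) (hp _)) (by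
      intro y _
      exact ((hcont.tendsto _).comp (hts.mul_const y)).div ((hcont.tendsto _).comp hts)
        (hp s).ne')
    have hpow : ∀ y, 1 ≤ y → p (s * y) = p s * y ^ (-b) := by
      intro y hy
      rw [← hr y hy]
      field_simp [(hp s).ne']
    have h1 : Tendsto (fun y => p (s * y * 2) / p (s * y)) atTop (𝓝 (2 ^ (-α))) :=
      (hRV 2 (by norm_num)).comp (tendsto_id.const_mul_atTop hs0)
    have h2 : Tendsto (fun y => p (s * y * 2) / p (s * y)) atTop (𝓝 (2 ^ (-b))) := by
      refine tendsto_const_nhds.congr' ?_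
      filter_upwards [eventually_ge_atTop 1] with y hy
      have hy0 : (0 : ℝ) < y := by linarith
      rw [mul_assoc, hpow _ (by linarith), hpow y hy, Real.mul_rpow hy0.le (by norm_num)]
      have := (hp s).ne'
      have := (Real.rpow_pos_of_pos hy0 (-b)).ne'
      field_simp
    have h3 := tendsto_nhds_unique h1 h2
    have hαb : α = b := by
      have := congrArg Real.log h3
      rw [Real.log_rpow (by norm_num), Real.log_rpow (by norm_num)] at this
      have hl2 : Real.log 2 ≠ 0 := (Real.log_pos (by norm_num)).ne'
      have := mul_right_cancel₀ hl2 this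
      linarith
    exact hne φ (hαb ▸ hb)
  -- Unbounded thresholds: along a subsequence going to infinity, regular variation gives the limit
  -- directly.
  · have hfreq : ∀ N : ℕ, ∃ᶠ m in atTop, (N : ℝ) < t m := by
      intro N hN
      apply hbdd
      have : ∀ᶠ m in atTop, t m ≤ N := by
        filter_upwards [hN] with m hm using not_lt.1 hm
      exact (IsBoundedUnder.bddAbove_range ⟨N, eventually_map.2 this⟩)
    obtain ⟨φ, hφ, hφt⟩ := extraction_forall_of_frequently hfreq
    have htop : Tendsto (t ∘ φ) atTop atTop :=
      tendsto_atTop_mono (fun m => (hφt m).le) tendsto_natCast_atTop_atTop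
    obtain ⟨b, hb, hr⟩ := key φ (fun y => y ^ (-α)) hφ (by positivity)
      (fun y hy => (hRV y (by linarith)).comp htop)
    have h3 := hr 2 (by norm_num)
    have hαb : α = b := by
      have := congrArg Real.log h3
      rw [Real.log_rpow (by norm_num), Real.log_rpow (by norm_num)] at this
      have hl2 : Real.log 2 ≠ 0 := (Real.log_pos (by norm_num)).ne'
      have := mul_right_cancel₀ hl2 this
      linarith
    exact hne φ (hαb ▸ hb)

/-- A Potter-type bound along the exponential scale. -/
lemma eventually_div_le_exp {p : ℝ → ℝ} {α : ℝ} (hα : 0 < α)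
    (hp : ∀ x, 0 < p x) (hanti : Antitone p) (hRV : RegularlyVarying p (-α)) :
    ∀ᶠ T in atTop, ∀ s : ℝ, 0 ≤ s →
      p (T * Real.exp s) / p T ≤ Real.exp (α / 2) * Real.exp (-(α / 2) * s) := by
  -- Halving the exponent leaves room for a bound on each step of ratio e, which is then iterated;
  -- the fractional part of s costs the factor exp(α/2).
  have he : Real.exp 1 ^ (-α) < Real.exp (-(α / 2)) := by
    rw [← Real.exp_mul, Real.exp_lt_exp]; linarith
  have h1 : ∀ᶠ T in atTop, p (T * Real.exp 1) / p T < Real.exp (-(α / 2)) :=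
    (hRV _ (Real.exp_pos 1)).eventually (gt_mem_nhds he)
  obtain ⟨T₀, hT₀⟩ := eventually_atTop.1 h1
  filter_upwards [eventually_ge_atTop (max T₀ 1)] with T hT
  have hTT₀ : T₀ ≤ T := (le_max_left _ _).trans hT
  have hT1 : 1 ≤ T := (le_max_right _ _).trans hT
  have hstep : ∀ m : ℕ, p (T * Real.exp m) ≤ p T * Real.exp (-(α / 2) * m) := by
    intro m
    induction m with
    | zero => simp
    | succ m ih =>
      have hge : T₀ ≤ T * Real.exp m :=
        hTT₀.trans (le_mul_of_one_le_right (by linarith) (Real.one_le_exp (by positivity)))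
      have h2 := (hT₀ _ hge).le
      rw [div_le_iff₀ (hp _), mul_assoc, ← Real.exp_add] at h2
      push_cast
      calc p (T * Real.exp (m + 1)) ≤ Real.exp (-(α / 2)) * p (T * Real.exp m) := h2
        _ ≤ Real.exp (-(α / 2)) * (p T * Real.exp (-(α / 2) * m)) := by gcongr
        _ = p T * Real.exp (-(α / 2) * (m + 1)) := by
          rw [mul_add, Real.exp_add, mul_one]; ring
  intro s hs
  rw [div_le_iff₀ (hp _)]
  have hfl := Nat.floor_le hs
  have hlt := Nat.lt_floor_add_one s
  calc p (T * Real.exp s) ≤ p (T * Real.exp ⌊s⌋₊) := by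
        apply hanti
        have : 0 ≤ T := by linarith
        gcongr
    _ ≤ p T * Real.exp (-(α / 2) * ⌊s⌋₊) := hstep _
    _ ≤ p T * Real.exp (α / 2 + -(α / 2) * s) := by
        have := (hp T).le
        gcongr
        nlinarith
    _ = _ := by rw [Real.exp_add]; ring

/-- Karamata's theorem for the integral of a regularly varying tail on the exponential scale. -/
lemma tendsto_integral_div {p : ℝ → ℝ} {α : ℝ} (hα : 0 < α)
    (hp : ∀ x, 0 < p x) (hanti : Antitone p) (hcont : Continuous p)
    (hRV : RegularlyVarying p (-α)) :
    Tendsto (fun T => (∫ s in Set.Ioi (0 : ℝ), p (T * Real.exp s)) / p T) atTop (𝓝 (1 / α)) := by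
  have hlim : ∫ s in Set.Ioi (0 : ℝ), Real.exp (-α * s) = 1 / α := by
    rw [integral_exp_mul_Ioi (by linarith)]
    simp
  rw [← hlim]
  simp_rw [← integral_div]
  refine tendsto_integral_filter_of_dominated_convergence
    (fun s => Real.exp (α / 2) * Real.exp (-(α / 2) * s)) ?_ ?_ ?_ ?_
  · filter_upwards with T
    exact (Continuous.aestronglyMeasurable (by fun_prop))
  · filter_upwards [eventually_div_le_exp hα hp hanti hRV] with T hT
    filter_upwards [ae_restrict_mem measurableSet_Ioi] with s hs
    rw [Real.norm_of_nonneg (div_nonneg (hp _).le (hp _).le)]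
    exact hT s (Set.mem_Ioi.1 hs).le
  · exact (integrableOn_exp_mul_Ioi (by linarith) 0).const_mul _
  · filter_upwards with s
    have := hRV (Real.exp s) (Real.exp_pos s)
    rwa [← Real.exp_mul, mul_neg, mul_comm s, ← neg_mul] at this

/-- The mean log-excess over a high threshold is finite and is an integral of the tail. -/
lemma integrable_log_excess {ν : Measure ℝ} [IsProbabilityMeasure ν] {p : ℝ → ℝ} {α : ℝ}
    (hα : 0 < α) (hpν : ∀ x, p x = ν.real (Set.Ioi x)) (hν : ∀ᵐ x ∂ν, 1 ≤ x)
    (hp : ∀ x, 0 < p x) (hcont : Continuous p) (hRV : RegularlyVarying p (-α)) :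
    ∀ᶠ T in atTop, Integrable (fun x => max (Real.log (x / T)) 0) ν ∧
      ∫ x, max (Real.log (x / T)) 0 ∂ν = ∫ s in Set.Ioi (0 : ℝ), p (T * Real.exp s) := by
  have hanti : Antitone p := fun a b h => by
    rw [hpν, hpν]; exact measureReal_mono (Set.Ioi_subset_Ioi h)
  filter_upwards [eventually_div_le_exp hα hp hanti hRV, eventually_gt_atTop 0] with T hT hT0
  have hmeas : Measurable fun x : ℝ => max (Real.log (x / T)) 0 := by fun_prop
  -- Layer-cake formula: the level sets of the log-excess are half-lines, up to a ν-null set.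
  have hset : ∀ s ∈ Set.Ioi (0 : ℝ),
      ν {x | s < max (Real.log (x / T)) 0} = ENNReal.ofReal (p (T * Real.exp s)) := by
    intro s hs
    rw [hpν, ofReal_measureReal]
    apply measure_congr
    filter_upwards [hν] with x hx
    have hs' : ¬ s < 0 := not_lt.2 (Set.mem_Ioi.1 hs).le
    have hx0 : 0 < x / T := by positivity
    apply propext
    change s < max (Real.log (x / T)) 0 ↔ T * Real.exp s < x
    rw [lt_max_iff, or_iff_left hs', Real.lt_log_iff_exp_lt hx0, lt_div_iff₀ hT0, mul_comm]
  have hl : ∫⁻ x, ENNReal.ofReal (max (Real.log (x / T)) 0) ∂ν =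
      ∫⁻ s in Set.Ioi (0 : ℝ), ENNReal.ofReal (p (T * Real.exp s)) := by
    rw [lintegral_eq_lintegral_meas_lt (f := fun x => max (Real.log (x / T)) 0) ν (ae_of_all _ fun x => le_max_right _ _)
      hmeas.aemeasurable]
    exact setLIntegral_congr_fun measurableSet_Ioi hset
  have hint : IntegrableOn (fun s => p (T * Real.exp s)) (Set.Ioi 0) := by
    refine Integrable.mono' (g := fun s => p T * (Real.exp (α / 2) * Real.exp (-(α / 2) * s)))
      (((integrableOn_exp_mul_Ioi (by linarith) 0).const_mul _).const_mul _)
      (Continuous.aestronglyMeasurable (by fun_prop)) ?_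
    filter_upwards [ae_restrict_mem measurableSet_Ioi] with s hs
    rw [Real.norm_of_nonneg (hp _).le]
    have := hT s (Set.mem_Ioi.1 hs).le
    rwa [div_le_iff₀ (hp T), mul_comm _ (p T)] at this
  have hnn : ∀ x : ℝ, 0 ≤ max (Real.log (x / T)) 0 := fun x => le_max_right _ _
  constructor
  · refine ⟨hmeas.aestronglyMeasurable, ?_⟩
    rw [hasFiniteIntegral_iff_ofReal (ae_of_all _ hnn), hl]
    exact (hasFiniteIntegral_iff_ofReal (ae_of_all _ fun s => (hp _).le)).1 hint.2
  · rw [integral_eq_lintegral_of_nonneg_ae (ae_of_all _ hnn) hmeas.aestronglyMeasurable, hl,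
      integral_eq_lintegral_of_nonneg_ae (ae_of_all _ fun s => (hp _).le)
        (Continuous.aestronglyMeasurable (by fun_prop))]

/-! ### Laws of large numbers for exceedance counts -/

/-- Weak law of large numbers: sums of a function with negative mean are eventually negative. -/
lemma tendsto_measure_sum_not_neg {Ω : Type*} [MeasurableSpace Ω] {P : Measure Ω}
    [IsProbabilityMeasure P] {ν : Measure ℝ} {X : ℕ → Ω → ℝ}
    (hX_meas : ∀ i, AEMeasurable (X i) P) (hX_law : ∀ i, P.map (X i) = ν)
    (hX_indep : iIndepFun X P) {f : ℝ → ℝ} (hf : Measurable f) (hint : Integrable f ν)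
    (hneg : ∫ x, f x ∂ν < 0) :
    Tendsto (fun n : ℕ => P {ω | ¬ ∑ i : Fin n, f (X i ω) < 0}) atTop (𝓝 0) := by
  have hmeas : ∀ i, AEMeasurable (fun ω => f (X i ω)) P := fun i =>
    hf.comp_aemeasurable (hX_meas i)
  have hint0 : Integrable (fun ω => f (X 0 ω)) P := by
    have h := hint
    rw [← hX_law 0] at h
    exact h.comp_aemeasurable (hX_meas 0)
  have hmean : ∫ ω, f (X 0 ω) ∂P = ∫ x, f x ∂ν := by
    rw [← hX_law 0, integral_map (hX_meas 0) hf.aestronglyMeasurable]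
  have hslln := strong_law_ae_real (fun i ω => f (X i ω)) hint0
    (fun i j hij => (hX_indep.indepFun hij).comp hf hf)
    (fun i => (IdentDistrib.mk (hX_meas i) (hX_meas 0)
      ((hX_law i).trans (hX_law 0).symm)).comp hf)
  rw [hmean] at hslln
  have hprob := tendstoInMeasure_of_tendsto_ae (fun n => by
    refine AEMeasurable.aestronglyMeasurable ?_
    exact (Finset.aemeasurable_fun_sum _ fun i _ => hmeas i).div_const _) hslln
  rw [tendstoInMeasure_iff_norm] at hprob
  refine tendsto_of_tendsto_of_tendsto_of_le_of_le' tendsto_const_nhds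
    -- A nonnegative sum puts the sample mean at distance at least -∫ f from its limit.
    (hprob (-∫ x, f x ∂ν) (by linarith)) (Eventually.of_forall fun _ => zero_le) ?_
  filter_upwards [eventually_ge_atTop 1] with n hn
  refine measure_mono fun ω hω => ?_
  simp only [Set.mem_ofPred_eq, not_lt] at hω ⊢
  have hn0 : (0 : ℝ) < n := by exact_mod_cast hn
  rw [Fin.sum_univ_eq_sum_range (fun i => f (X i ω))] at hω
  refine le_trans ?_ (Real.le_norm_self _)
  have := div_nonneg hω hn0.le
  linarith

/-- Chebyshev, with the variance of an indicator bounded by its mean. At a relative deviation the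
bound decays like the inverse of the expected count, hence is summable along geometric levels. -/
lemma measure_abs_exceedances_sub_ge {Ω : Type*} [MeasurableSpace Ω] {P : Measure Ω}
    [IsProbabilityMeasure P] {ν : Measure ℝ} {X : ℕ → Ω → ℝ}
    (hX_meas : ∀ i, AEMeasurable (X i) P) (hX_law : ∀ i, P.map (X i) = ν)
    (hX_indep : iIndepFun X P) (n : ℕ) (u : ℝ) {c : ℝ} (hc : 0 < c) :
    P {ω | c ≤ |exceedances (fun i : Fin n => X i ω) u - n * ν.real (Set.Ioi u)|} ≤
      ENNReal.ofReal (n * ν.real (Set.Ioi u) / c ^ 2) := by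
  set f : ℝ → ℝ := (Set.Ioi u).indicator (fun _ => (1 : ℝ)) with hfdef
  have hf : Measurable f := measurable_const.indicator measurableSet_Ioi
  set Y : ℕ → Ω → ℝ := fun i ω => f (X i ω) with hY
  have hmeas : ∀ i, AEMeasurable (Y i) P := fun i => hf.comp_aemeasurable (hX_meas i)
  have hbd : ∀ i ω, ‖Y i ω‖ ≤ 1 := fun i ω => by
    simp only [hY, hfdef, Set.indicator_apply]; split_ifs <;> simp
  have hLp : ∀ i, MemLp (Y i) 2 P := fun i =>
    MemLp.of_bound (hmeas i).aestronglyMeasurable 1 (ae_of_all _ (hbd i))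
  have hmean : ∀ i, ∫ ω, Y i ω ∂P = ν.real (Set.Ioi u) := by
    intro i
    rw [hY, ← integral_map (f := f) (hX_meas i) hf.aestronglyMeasurable, hX_law i, hfdef,
      integral_indicator_const _ measurableSet_Ioi]
    simp
  have hvar : ∀ i, Var[Y i; P] ≤ ν.real (Set.Ioi u) := by
    intro i
    refine (variance_le_expectation_sq (hmeas i).aestronglyMeasurable).trans_eq ?_
    rw [← hmean i]
    congr 1
    ext ω
    simp only [Pi.pow_apply, hY, hfdef, Set.indicator_apply]
    split_ifs <;> simp
  have hsumvar : Var[∑ i ∈ Finset.range n, Y i; P] ≤ n * ν.real (Set.Ioi u) := by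
    rw [IndepFun.variance_sum (fun i _ => hLp i)
      (fun i _ j _ hij => (hX_indep.indepFun hij).comp hf hf)]
    calc _ ≤ ∑ _i ∈ Finset.range n, ν.real (Set.Ioi u) := Finset.sum_le_sum fun i _ => hvar i
      _ = _ := by simp
  have hsummean : ∫ ω, (∑ i ∈ Finset.range n, Y i) ω ∂P = n * ν.real (Set.Ioi u) := by
    simp only [Finset.sum_apply]
    rw [integral_finsetSum _ fun i _ => (hLp i).integrable (by norm_num)]
    simp [hmean]
  have hcheb := meas_ge_le_variance_div_sq
    (memLp_finsetSum' (Finset.range n) fun i _ => hLp i) hc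
  rw [hsummean] at hcheb
  have hexc : ∀ ω, exceedances (fun i : Fin n => X i ω) u = (∑ i ∈ Finset.range n, Y i) ω := by
    intro ω
    rw [exceedances, Finset.sum_apply, ← Fin.sum_univ_eq_sum_range (fun i => Y i ω)]
  simp only [hexc]
  refine hcheb.trans (ENNReal.ofReal_le_ofReal ?_)
  gcongr

/-- Deviations on a geometric grid of levels control the deviations at all levels. -/
lemma abs_sub_le_of_geometric_grid {p M : ℝ → ℝ} {n K ε : ℝ} (hε : 0 < ε) (hε1 : ε ≤ 1)
    (hK : 0 < K) (hn : 0 < n) (hp : Antitone p) (hM : Antitone M)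
    (hp1 : ∀ u, p u ≤ 1) (hp0 : ∀ u, 0 ≤ p u) (hM0 : ∀ u, 0 ≤ M u) (hMn : ∀ u, M u ≤ n)
    {z : ℕ → ℝ} (hz : ∀ i, K * (1 + ε) ^ i ≤ n → n * p (z i) = K * (1 + ε) ^ i)
    (hdev : ∀ i, K * (1 + ε) ^ i ≤ n →
      |M (z i) - K * (1 + ε) ^ i| ≤ ε * (K * (1 + ε) ^ i)) (u : ℝ) :
    |M u - n * p u| ≤ 3 * ε * (n * p u) + 2 * K := by
  have hv0 : 0 ≤ n * p u := mul_nonneg hn.le (hp0 u)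
  have hvn : n * p u ≤ n := mul_le_of_le_one_right hn.le (hp1 u)
  set v := n * p u with hv
  have hup : ∀ i, v < K * (1 + ε) ^ i → M u ≤ (1 + ε) * (K * (1 + ε) ^ i) := by
    intro i hi
    by_cases hin : K * (1 + ε) ^ i ≤ n
    · have hlt : p u < p (z i) := by
        have := hz i hin
        rw [hv, ← this] at hi
        exact lt_of_mul_lt_mul_left hi hn.le
      have h1 : z i ≤ u := by
        by_contra! h
        exact absurd (hp h.le) (not_le.2 hlt)
      have := hM h1
      linarith [(abs_le.1 (hdev i hin)).2]
    · have h1 := hMn u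
      have h2 : 0 < K * (1 + ε) ^ i := by positivity
      nlinarith
  have hlow : ∀ i, K * (1 + ε) ^ i < v → (1 - ε) * (K * (1 + ε) ^ i) ≤ M u := by
    intro i hi
    have hin : K * (1 + ε) ^ i ≤ n := by linarith
    have hlt : p (z i) < p u := by
      have := hz i hin
      rw [hv, ← this] at hi
      exact lt_of_mul_lt_mul_left hi hn.le
    have h1 : u ≤ z i := by
      by_contra! h
      exact absurd (hp h.le) (not_le.2 hlt)
    have := hM h1
    linarith [(abs_le.1 (hdev i hin)).1]
  have hMu := hM0 u
  rcases lt_or_ge v K with hvK | hvK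
  · have := hup 0 (by simpa using hvK)
    rw [pow_zero, mul_one] at this
    rw [abs_le]
    constructor <;> nlinarith
  · obtain ⟨i, hi1, hi2⟩ := exists_nat_pow_near (x := v / K) (y := 1 + ε)
      ((one_le_div hK).2 hvK) (by linarith)
    rw [le_div_iff₀ hK, mul_comm] at hi1
    rw [div_lt_iff₀ hK, mul_comm] at hi2
    have h1 := hup (i + 1) hi2
    rw [pow_succ] at h1 hi2
    have h2 : M u ≤ (1 + ε) ^ 2 * v := by nlinarith [mul_nonneg hε.le hε.le]
    have h3 : M u - v ≤ 3 * ε * v + 2 * K := by nlinarith [mul_nonneg hε.le hv0]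
    -- `hlow` needs a level strictly below v, so the level one step lower is used; at the lowest
    -- level v < 2K suffices.
    have h4 : v - M u ≤ 3 * ε * v + 2 * K := by
      cases i with
      | zero => rw [pow_zero] at hi2; nlinarith
      | succ i =>
        rw [pow_succ] at hi1 hi2
        have hpos : 0 < K * (1 + ε) ^ i := by positivity
        set w := K * (1 + ε) ^ i with hw
        have hi1' : w * (1 + ε) ≤ v := by rw [hw]; linarith
        have hi2' : v < w * (1 + ε) ^ 2 := by rw [hw]; linarith
        have h5 : (1 - ε) * w ≤ M u := hlow i (by rw [← hw]; nlinarith)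
        by_cases h3ε : 1 ≤ 3 * ε
        · nlinarith
        · have h6 : (1 - 3 * ε) * v ≤ (1 - 3 * ε) * (w * (1 + ε) ^ 2) :=
            mul_le_mul_of_nonneg_left hi2'.le (by linarith)
          have h7 : (1 - 3 * ε) * (w * (1 + ε) ^ 2) ≤ (1 - ε) * w := by
            have : (1 - 3 * ε) * (1 + ε) ^ 2 ≤ 1 - ε := by nlinarith [pow_pos hε 3, pow_pos hε 2]
            nlinarith
          linarith
    rw [abs_le]
    constructor <;> linarith

/-- Uniform relative concentration of the exceedance counts of an i.i.d. sample, up to an additive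
constant that does not depend on the sample size. -/
lemma exists_measure_exceedances_deviation_le {Ω : Type*} [MeasurableSpace Ω] {P : Measure Ω}
    [IsProbabilityMeasure P] {ν : Measure ℝ} [IsProbabilityMeasure ν] {X : ℕ → Ω → ℝ}
    (hX_meas : ∀ i, AEMeasurable (X i) P) (hX_law : ∀ i, P.map (X i) = ν)
    (hX_indep : iIndepFun X P) (hcont : Continuous (tail (cdf ν)))
    (hpν : ∀ u, tail (cdf ν) u = ν.real (Set.Ioi u)) {u₀ : ℝ} (hu₀ : tail (cdf ν) u₀ = 1)
    {ε ρ : ℝ} (hε : 0 < ε) (hρ : 0 < ρ) :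
    ∃ K > 0, ∀ n : ℕ, P {ω | ¬ ∀ u,
      |exceedances (fun i : Fin n => X i ω) u - n * tail (cdf ν) u| ≤
        ε * (n * tail (cdf ν) u) + K} ≤ ENNReal.ofReal ρ := by
  set p := tail (cdf ν) with hp
  have hanti : Antitone p := fun a b h => by
    rw [hpν, hpν]; exact measureReal_mono (Set.Ioi_subset_Ioi h)
  have hp0 : ∀ u, 0 ≤ p u := fun u => by rw [hpν]; exact measureReal_nonneg
  have hp1 : ∀ u, p u ≤ 1 := fun u => by rw [hpν]; exact measureReal_le_one
  have hlim : Tendsto p atTop (𝓝 0) := by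
    have := (tendsto_cdf_atTop ν).const_sub 1
    rwa [sub_self] at this
  have hsurj : ∀ v : ℝ, 0 < v → v ≤ 1 → ∃ z, p z = v := fun v hv0 hv1 =>
    mem_range_of_exists_le_of_exists_ge hcont
      ((hlim.eventually (gt_mem_nhds hv0)).exists.imp fun _ h => h.le) ⟨u₀, hu₀ ▸ hv1⟩
  set δ := min (ε / 3) 1 with hδ
  have hδ0 : 0 < δ := by positivity
  have hδ1 : δ ≤ 1 := min_le_right _ _
  have hδε : 3 * δ ≤ ε := by linarith [min_le_left (ε / 3) 1]
  -- Chosen so that the Chebyshev bounds 1/(δ²K(1+δ)^i) sum over i to exactly ρ.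
  set K := (1 + δ) / (δ ^ 3 * ρ) with hK
  have hK0 : 0 < K := by positivity
  refine ⟨2 * K, by positivity, fun n => ?_⟩
  rcases Nat.eq_zero_or_pos n with rfl | hn
  · have : {ω | ¬ ∀ u, |exceedances (fun i : Fin 0 => X i ω) u - (0 : ℕ) * p u| ≤
        ε * ((0 : ℕ) * p u) + 2 * K} = ∅ := by
      ext ω
      simp [exceedances, hK0.le]
    rw [this]
    simp
  have hn0 : (0 : ℝ) < n := by exact_mod_cast hn
  -- Continuity of p lets every level be attained exactly; levels above n get a dummy point.
  have hlev : ∀ i : ℕ, ∃ z, K * (1 + δ) ^ i ≤ n → n * p z = K * (1 + δ) ^ i := by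
    intro i
    by_cases h : K * (1 + δ) ^ i ≤ n
    · obtain ⟨z, hz⟩ := hsurj (K * (1 + δ) ^ i / n) (by positivity) ((div_le_one hn0).2 h)
      exact ⟨z, fun _ => by rw [hz]; field_simp⟩
    · exact ⟨0, fun h' => absurd h' h⟩
  choose z hz using hlev
  set B : ℕ → Set Ω := fun i => {ω | K * (1 + δ) ^ i ≤ n ∧ δ * (K * (1 + δ) ^ i) ≤
    |exceedances (fun i : Fin n => X i ω) (z i) - K * (1 + δ) ^ i|} with hB
  have hBle : ∀ i, P (B i) ≤ ENNReal.ofReal (1 / (δ ^ 2 * K) * (1 / (1 + δ)) ^ i) := by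
    intro i
    by_cases h : K * (1 + δ) ^ i ≤ n
    · have hzi := hz i h
      have hcheb := measure_abs_exceedances_sub_ge hX_meas hX_law hX_indep n (z i)
        (show 0 < δ * (K * (1 + δ) ^ i) by positivity)
      rw [← hpν, hzi] at hcheb
      refine (measure_mono fun ω hω => hω.2).trans (hcheb.trans_eq ?_)
      congr 1
      rw [one_div_pow]
      field_simp
    · have : B i = ∅ := by ext ω; simp [hB, h]
      rw [this]; simp
  have hsub : {ω | ¬ ∀ u, |exceedances (fun i : Fin n => X i ω) u - n * p u| ≤
      ε * (n * p u) + 2 * K} ⊆ ⋃ i, B i := by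
    intro ω hω
    by_contra hcon
    apply hω
    intro u
    simp only [hB, Set.mem_iUnion, Set.mem_ofPred_eq, not_exists, not_and, not_le] at hcon
    have := abs_sub_le_of_geometric_grid hδ0 hδ1 hK0 hn0 hanti (exceedances_antitone _) hp1 hp0
      (exceedances_nonneg _) (exceedances_le _) hz (fun i hi => (hcon i hi).le) u
    have hnp : 0 ≤ n * p u := mul_nonneg hn0.le (hp0 u)
    nlinarith
  have hr0 : 0 ≤ 1 / (1 + δ) := by positivity
  have hr1 : 1 / (1 + δ) < 1 := by rw [div_lt_one (by positivity)]; linarith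
  calc _ ≤ P (⋃ i, B i) := measure_mono hsub
    _ ≤ ∑' i, P (B i) := measure_iUnion_le _
    _ ≤ ∑' i, ENNReal.ofReal (1 / (δ ^ 2 * K) * (1 / (1 + δ)) ^ i) := ENNReal.tsum_le_tsum hBle
    _ = ENNReal.ofReal (∑' i, 1 / (δ ^ 2 * K) * (1 / (1 + δ)) ^ i) :=
        (ENNReal.ofReal_tsum_of_nonneg (fun i => by positivity)
          ((summable_geometric_of_lt_one hr0 hr1).mul_left _)).symm
    _ = ENNReal.ofReal ρ := by
        rw [tsum_mul_left, tsum_geometric_of_lt_one hr0 hr1, hK]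
        congr 1
        have : 1 - 1 / (1 + δ) = δ / (1 + δ) := by field_simp; ring
        rw [this]
        field_simp

/-! ### Smallness of the minimal Kolmogorov-Smirnov distance -/

/-- Sufficient conditions, linear in sums over the sample, for the existence of a small
Kolmogorov-Smirnov distance. -/
lemma exists_ksDist_le {n : ℕ} (x : Fin n → ℝ) (hx : ∀ i, 0 < x i) {α η c d T T' : ℝ}
    {G : Finset ℝ}
    (hG : ∀ g : ℝ → ℝ, AntitoneOn g (Set.Ici 1) → (∀ y, 1 ≤ y → 0 ≤ g y) →
        (∀ y ∈ G, |g y - y ^ (-α)| ≤ c) → ∀ y, 1 ≤ y → |g y - y ^ (-α)| ≤ η)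
    (hG1 : ∀ y ∈ G, 1 ≤ y)
    (hd : ∀ H : ℝ, |H - 1 / α| < d → ∀ y : ℝ, 1 ≤ y → |y ^ (-H⁻¹) - y ^ (-α)| ≤ η)
    (hT' : 0 < T') (hTpos : 0 < exceedances x T) (hTT' : exceedances x T < exceedances x T')
    (hup : ∀ y ∈ G, exceedances x (T' * y) < (y ^ (-α) + c) * exceedances x T)
    (hlow : ∀ y ∈ G, (y ^ (-α) - c) * exceedances x T < exceedances x (T * y))
    (hSup : ∑ i, max (Real.log (x i / T')) 0 < (1 / α + d) * exceedances x T)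
    (hSlow : (1 / α - d) * exceedances x T < ∑ i, max (Real.log (x i / T)) 0) :
    ∃ k, 1 ≤ k ∧ k < n ∧ ksDist x k ≤ 2 * η := by
  -- With k = M(T), the order statistic X_{n-k:n} lies in (T', T], so monotonicity transfers the
  -- bounds at the two fixed thresholds to it.
  obtain ⟨k, hk⟩ := exists_nat_exceedances x T
  have hk0 : (0 : ℝ) < k := hk ▸ hTpos
  have hk1 : 1 ≤ k := by exact_mod_cast hk0
  have hkn : k < n := by
    have : (k : ℝ) < n := by rw [← hk]; exact hTT'.trans_le (exceedances_le x T')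
    exact_mod_cast this
  refine ⟨k, hk1, hkn, ksDist_le x hkn hx fun y hy => ?_⟩
  have htT : orderStat x (n - k) ≤ T := orderStat_le_of_exceedances_le x hkn hk.le
  have hT't : T' < orderStat x (n - k) := lt_orderStat_of_lt_exceedances x hkn (hk ▸ hTT')
  have hH := hillStat_eq x hkn hx
  have ht := orderStat_pos x hkn hx
  set t := orderStat x (n - k) with htdef
  rw [hk] at hup hlow hSup hSlow
  have h1 : |exceedances x (t * y) / k - y ^ (-α)| ≤ η := by
    refine hG (fun y => exceedances x (t * y) / k) ?_ ?_ ?_ y hy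
    · intro a _ b _ hab
      simp only
      gcongr
      exact exceedances_antitone x (by gcongr)
    · intro y _
      exact div_nonneg (exceedances_nonneg _ _) hk0.le
    · intro y hy
      have hy0 : 0 ≤ y := zero_le_one.trans (hG1 y hy)
      have h1 := exceedances_antitone x (mul_le_mul_of_nonneg_right hT't.le hy0)
      have h2 := exceedances_antitone x (mul_le_mul_of_nonneg_right htT hy0)
      have h3 : exceedances x (t * y) / k ≤ y ^ (-α) + c := by
        rw [div_le_iff₀ hk0]; linarith [hup y hy]
      have h4 : y ^ (-α) - c ≤ exceedances x (t * y) / k := by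
        rw [le_div_iff₀ hk0]; linarith [hlow y hy]
      rw [abs_le]
      constructor <;> linarith
  have h2 : |y ^ (-hillEstimator x k) - y ^ (-α)| ≤ η := by
    refine hd _ ?_ y hy
    have h3 : ∑ i, max (Real.log (x i / t)) 0 ≤ ∑ i, max (Real.log (x i / T')) 0 := by
      refine Finset.sum_le_sum fun i _ => max_le_max_right 0 ?_
      exact Real.log_le_log (div_pos (hx i) ht) (div_le_div_of_nonneg_left (hx i).le hT' hT't.le)
    have h4 : ∑ i, max (Real.log (x i / T)) 0 ≤ ∑ i, max (Real.log (x i / t)) 0 := by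
      refine Finset.sum_le_sum fun i _ => max_le_max_right 0 ?_
      exact Real.log_le_log (div_pos (hx i) (ht.trans_le htT))
        (div_le_div_of_nonneg_left (hx i).le ht htT)
    have h5 : hillStat x k < 1 / α + d := by
      rw [hH, one_div_mul_eq_div, div_lt_iff₀ hk0]; linarith
    have h6 : 1 / α - d < hillStat x k := by
      rw [hH, one_div_mul_eq_div, lt_div_iff₀ hk0]; linarith
    rw [abs_lt]
    constructor <;> linarith
  rw [abs_le] at h1 h2 ⊢
  constructor <;> linarith [h1.1, h1.2, h2.1, h2.2]

/-- Thresholds at which the mean versions of the conditions of `exists_ksDist_le` hold. -/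
lemma exists_thresholds {p S : ℝ → ℝ} {α c d : ℝ} (hα : 0 < α) (hc : 0 < c) (hd : 0 < d)
    (hp : ∀ x, 0 < p x) (hRV : RegularlyVarying p (-α))
    (hS : Tendsto (fun T => S T / p T) atTop (𝓝 (1 / α))) {Q : ℝ → Prop}
    (hQ : ∀ᶠ T in atTop, Q T) (G : Finset ℝ) (hG1 : ∀ y ∈ G, 1 ≤ y) :
    ∃ T T', 0 < T' ∧ Q T ∧ Q T' ∧ p T < p T' ∧
      (∀ y ∈ G, p (T' * y) < (y ^ (-α) + c) * p T) ∧
      (∀ y ∈ G, (y ^ (-α) - c) * p T < p (T * y)) ∧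
      S T' < (1 / α + d) * p T ∧ (1 / α - d) * p T < S T := by
  have hb1 : Tendsto (fun b : ℝ => b ^ (-α)) (𝓝[>] 1) (𝓝 1) := by
    have := (Real.continuousAt_rpow_const (1 : ℝ) (-α) (Or.inl one_ne_zero)).tendsto
    rw [Real.one_rpow] at this
    exact this.mono_left nhdsWithin_le_nhds
  have hbG : ∀ᶠ b : ℝ in 𝓝[>] 1, ∀ y ∈ G, y ^ (-α) < (y ^ (-α) + c) * b ^ (-α) := by
    rw [Filter.eventually_all_finset]
    intro y _
    refine (hb1.const_mul _).eventually (lt_mem_nhds ?_)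
    linarith
  have hbS : ∀ᶠ b : ℝ in 𝓝[>] 1, 1 / α < (1 / α + d) * b ^ (-α) :=
    (hb1.const_mul _).eventually (lt_mem_nhds (by linarith))
  -- The thresholds will be T' = t and T = tb. Taking b > 1 close to 1 keeps p(T)/p(T') below 1, yet
  -- near enough to 1 to fit within the slacks c and d.
  obtain ⟨b, hbG, hbS, hb⟩ := (hbG.and (hbS.and self_mem_nhdsWithin)).exists
  have hb : 1 < b := hb
  have hb0 : 0 < b := by linarith
  have htop : Tendsto (fun t : ℝ => t * b) atTop atTop := tendsto_id.atTop_mul_const hb0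
  have hblt : b ^ (-α) < 1 := Real.rpow_lt_one_of_one_lt_of_neg hb (by linarith)
  have e1 : ∀ᶠ t in atTop, p (t * b) / p t < 1 := (hRV b hb0).eventually (gt_mem_nhds hblt)
  have e2 : ∀ᶠ t in atTop, ∀ y ∈ G, p (t * y) / p t < (y ^ (-α) + c) * (p (t * b) / p t) := by
    rw [Filter.eventually_all_finset]
    intro y hy
    exact (hRV y (by linarith [hG1 y hy])).eventually_lt ((hRV b hb0).const_mul _) (hbG y hy)
  have e3 : ∀ᶠ t in atTop, ∀ y ∈ G, y ^ (-α) - c < p (t * y) / p t := by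
    rw [Filter.eventually_all_finset]
    intro y hy
    exact (hRV y (by linarith [hG1 y hy])).eventually (lt_mem_nhds (by linarith))
  have e4 : ∀ᶠ t in atTop, S t / p t < (1 / α + d) * (p (t * b) / p t) :=
    hS.eventually_lt ((hRV b hb0).const_mul _) hbS
  have e5 : ∀ᶠ t in atTop, 1 / α - d < S t / p t := hS.eventually (lt_mem_nhds (by linarith))
  obtain ⟨t, e1, e2, e3, e4, e5, q1, q2, ht⟩ := (e1.and (e2.and ((htop.eventually e3).and
    (e4.and ((htop.eventually e5).and (hQ.and ((htop.eventually hQ).and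
      (eventually_gt_atTop 0)))))))).exists
  refine ⟨t * b, t, ht, q2, q1, (div_lt_one (hp t)).1 e1, fun y hy => ?_, fun y hy => ?_, ?_, ?_⟩
  · have := e2 y hy
    rwa [← mul_div_assoc, div_lt_div_iff_of_pos_right (hp t)] at this
  · exact (lt_div_iff₀ (hp _)).1 (e3 y hy)
  · rwa [← mul_div_assoc, div_lt_div_iff_of_pos_right (hp t)] at e4
  · exact (lt_div_iff₀ (hp _)).1 e5

/-- The minimal Kolmogorov-Smirnov distance tends to zero in probability. -/
lemma tendsto_measure_not_exists_ksDist_le {Ω : Type*} [MeasurableSpace Ω] {P : Measure Ω}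
    [IsProbabilityMeasure P] {ν : Measure ℝ} [IsProbabilityMeasure ν] {X : ℕ → Ω → ℝ}
    (hX_meas : ∀ i, AEMeasurable (X i) P) (hX_law : ∀ i, P.map (X i) = ν)
    (hX_indep : iIndepFun X P) {α : ℝ} (hα : 0 < α) {p : ℝ → ℝ}
    (hpν : ∀ u, p u = ν.real (Set.Ioi u)) (hν : ∀ᵐ x ∂ν, 1 ≤ x)
    (hp : ∀ u, 0 < p u) (hcont : Continuous p) (hRV : RegularlyVarying p (-α))
    {η : ℝ} (hη : 0 < η) :
    Tendsto (fun n : ℕ => P {ω | (∀ i, 1 ≤ X i ω) ∧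
      ¬ ∃ k, 1 ≤ k ∧ k < n ∧ ksDist (fun i : Fin n => X i ω) k ≤ η}) atTop (𝓝 0) := by
  have hη2 : 0 < η / 2 := by positivity
  have hanti : Antitone p := fun a b h => by
    rw [hpν, hpν]; exact measureReal_mono (Set.Ioi_subset_Ioi h)
  obtain ⟨G, c, hc, hG1, hG⟩ := exists_grid_rpow_neg hα hη2
  have hinv : Tendsto (fun H : ℝ => H⁻¹) (𝓝 (1 / α)) (𝓝 α) := by
    have := tendsto_inv₀ (one_div_ne_zero hα.ne')
    simpa using this
  obtain ⟨d, hd0, hd⟩ := Metric.eventually_nhds_iff.1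
    (hinv.eventually (eventually_abs_rpow_neg_sub_le hα hη2))
  simp only [Real.dist_eq] at hd
  set S : ℝ → ℝ := fun T => ∫ x, max (Real.log (x / T)) 0 ∂ν with hSdef
  have hlogex := integrable_log_excess hα hpν hν hp hcont hRV
  have hS : Tendsto (fun T => S T / p T) atTop (𝓝 (1 / α)) := by
    refine (tendsto_integral_div hα hp hanti hcont hRV).congr' ?_
    filter_upwards [hlogex] with T hT
    simp only [hSdef]
    rw [hT.2]
  obtain ⟨T, T', hT', q1, q2, hpT, hup, hlow, hSup, hSlow⟩ :=
    exists_thresholds hα hc hd0 hp hRV hS (hlogex.mono fun _ h => h.1) G hG1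
  set I : ℝ → ℝ → ℝ := fun u => (Set.Ioi u).indicator fun _ => (1 : ℝ) with hI
  set L : ℝ → ℝ → ℝ := fun u x => max (Real.log (x / u)) 0 with hL
  have hIm : ∀ u, Measurable (I u) := fun u => measurable_const.indicator measurableSet_Ioi
  have hLm : ∀ u, Measurable (L u) := fun u => by simp only [hL]; fun_prop
  have hIi : ∀ u, Integrable (I u) ν := fun u =>
    (integrable_const (1 : ℝ)).indicator measurableSet_Ioi
  have hIint : ∀ u, ∫ x, I u x ∂ν = p u := fun u => by
    rw [hpν]
    simp only [hI]
    rw [integral_indicator_const _ measurableSet_Ioi]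
    simp
  -- comparison of the sample sums of two functions from the comparison of their means
  have lln : ∀ f g : ℝ → ℝ, Measurable f → Measurable g → Integrable f ν → Integrable g ν →
      ∀ a : ℝ, ∫ x, f x ∂ν < a * ∫ x, g x ∂ν →
      Tendsto (fun n : ℕ => P {ω | ¬ ∑ i : Fin n, f (X i ω) < a * ∑ i : Fin n, g (X i ω)})
        atTop (𝓝 0) := by
    intro f g hf hg hfi hgi a h
    have := tendsto_measure_sum_not_neg hX_meas hX_law hX_indep (f := fun x => f x - a * g x)
      (by fun_prop) (hfi.sub (hgi.const_mul a)) (by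
        rw [integral_sub hfi (hgi.const_mul a), integral_const_mul]; linarith)
    simpa only [Finset.sum_sub_distrib, ← Finset.mul_sum, sub_neg] using this
  have lln' : ∀ f g : ℝ → ℝ, Measurable f → Measurable g → Integrable f ν → Integrable g ν →
      ∀ a : ℝ, a * ∫ x, g x ∂ν < ∫ x, f x ∂ν →
      Tendsto (fun n : ℕ => P {ω | ¬ a * ∑ i : Fin n, g (X i ω) < ∑ i : Fin n, f (X i ω)})
        atTop (𝓝 0) := by
    intro f g hf hg hfi hgi a h
    have := tendsto_measure_sum_not_neg hX_meas hX_law hX_indep (f := fun x => a * g x - f x)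
      (by fun_prop) ((hgi.const_mul a).sub hfi) (by
        rw [integral_sub (hgi.const_mul a) hfi, integral_const_mul]; linarith)
    simpa only [Finset.sum_sub_distrib, ← Finset.mul_sum, sub_neg] using this
  -- The coefficient 0 encodes positivity of the count M(T).
  have t1 := lln' (I T) (I T) (hIm _) (hIm _) (hIi _) (hIi _) 0 (by
    rw [hIint, zero_mul]; exact hp T)
  have t2 := lln (I T) (I T') (hIm _) (hIm _) (hIi _) (hIi _) 1 (by
    rw [hIint, hIint, one_mul]; exact hpT)
  have t3 : ∀ y ∈ G, _ := fun y hy =>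
    lln (I (T' * y)) (I T) (hIm _) (hIm _) (hIi _) (hIi _) (y ^ (-α) + c) (by
      rw [hIint, hIint]; exact hup y hy)
  have t4 : ∀ y ∈ G, _ := fun y hy =>
    lln' (I (T * y)) (I T) (hIm _) (hIm _) (hIi _) (hIi _) (y ^ (-α) - c) (by
      rw [hIint, hIint]; exact hlow y hy)
  have t5 := lln (L T') (I T) (hLm _) (hIm _) q2 (hIi _) (1 / α + d) (by
    rw [hIint]; exact hSup)
  have t6 := lln' (L T) (I T) (hLm _) (hIm _) q1 (hIi _) (1 / α - d) (by
    rw [hIint]; exact hSlow)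
  have t3' := tendsto_finsetSum G t3
  have t4' := tendsto_finsetSum G t4
  have htot := t1.add (t2.add (t3'.add (t4'.add (t5.add t6))))
  simp only [Finset.sum_const_zero, add_zero] at htot
  refine tendsto_of_tendsto_of_tendsto_of_le_of_le tendsto_const_nhds htot
    (fun _ => zero_le) fun n => ?_
  simp only
  refine le_trans ?_ (add_le_add_right (add_le_add_right (add_le_add
    (measure_biUnion_finset_le G _) (add_le_add_left (measure_biUnion_finset_le G _) _)) _) _)
  refine le_trans ?_ ((measure_union_le _ _).trans (add_le_add_right ((measure_union_le _ _).trans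
    (add_le_add_right ((measure_union_le _ _).trans (add_le_add_right
      ((measure_union_le _ _).trans (add_le_add_right (measure_union_le _ _) _)) _)) _)) _))
  refine measure_mono fun ω hω => ?_
  by_contra hcon
  simp only [Set.mem_union, Set.mem_iUnion, Set.mem_ofPred_eq, not_or, not_exists, not_not,
    exists_prop, not_and] at hcon
  obtain ⟨c1, c2, c3, c4, c5, c6⟩ := hcon
  refine hω.2 ?_
  rw [zero_mul] at c1
  rw [one_mul] at c2
  have := exists_ksDist_le (fun i : Fin n => X i ω) (fun i => by linarith [hω.1 i]) hG hG1
    (fun H hH => hd hH) hT' c1 c2 c3 c4 c5 c6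
  rwa [mul_div_cancel₀ η two_ne_zero] at this

/-! ### Consistency -/

/-- On the event of uniform concentration, the empirical law of the `k` largest normalized
observations is uniformly close to the conditional law beyond the random threshold. -/
lemma abs_exceedances_div_sub_le {n : ℕ} (x : Fin n → ℝ) (hx : ∀ i, 0 < x i) {p : ℝ → ℝ}
    (hp : ∀ u, 0 < p u) (hanti : Antitone p) (hcont : Continuous p) {δ K : ℝ}
    (hδ : 0 < δ) (hδ4 : δ ≤ 1 / 4) (hK : 0 < K)
    (hdev : ∀ u, |exceedances x u - n * p u| ≤ δ * (n * p u) + K)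
    {k : ℕ} (hkn : k < n) (hk : K ≤ δ * k) {y : ℝ} (hy : 1 ≤ y) :
    |exceedances x (orderStat x (n - k) * y) / k -
      p (orderStat x (n - k) * y) / p (orderStat x (n - k))| ≤ 6 * δ := by
  have ht := orderStat_pos x hkn hx
  have h1 := exceedances_orderStat_le x hkn
  have h2 : ∀ u < orderStat x (n - k), (k : ℝ) ≤ (1 + δ) * (n * p u) + K := fun u hu => by
    linarith [succ_le_exceedances x hkn hu, (abs_le.1 (hdev u)).2]
  set t := orderStat x (n - k)
  -- Ties could make M(t) smaller than k, so the bound is taken at u < t and passed to the limit by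
  -- continuity of p.
  have h3 : (k : ℝ) ≤ (1 + δ) * (n * p t) + K := by
    have hc : Tendsto (fun u => (1 + δ) * (n * p u) + K) (𝓝[<] t)
        (𝓝 ((1 + δ) * (n * p t) + K)) :=
      Tendsto.mono_left (Continuous.tendsto (by fun_prop) t) nhdsWithin_le_nhds
    refine ge_of_tendsto hc ?_
    filter_upwards [self_mem_nhdsWithin] with u hu using h2 u hu
  have h4 := (abs_le.1 (hdev t)).1
  have hk0 : (0 : ℝ) < k := by
    by_contra! h
    nlinarith
  have hn0 : (0 : ℝ) < n := by
    have : (k : ℝ) < n := by exact_mod_cast hkn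
    linarith
  have hA0 : 0 < n * p t := mul_pos hn0 (hp t)
  have hBA : n * p (t * y) ≤ n * p t := by
    gcongr
    exact hanti (le_mul_of_one_le_right ht.le hy)
  have hB0 : 0 < n * p (t * y) := mul_pos hn0 (hp _)
  have hM := hdev (t * y)
  have hratio : p (t * y) / p t = n * p (t * y) / (n * p t) := by
    rw [mul_div_mul_left _ _ hn0.ne']
  rw [hratio]
  set A := n * p t
  set B := n * p (t * y)
  set M := exceedances x (t * y)
  have hA2 : A ≤ 2 * k := by nlinarith
  have hq0 : 0 ≤ B / A := by positivity
  have hq1 : B / A ≤ 1 := (div_le_one hA0).2 hBA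
  have hkA : |A - k| ≤ δ * A + K := by
    rw [abs_le]; constructor <;> linarith
  have hMB : |M - B| ≤ δ * A + K := hM.trans (by gcongr)
  -- Since B/A ≤ 1, both errors are at most δA + K ≤ 3δk, which gives the constant 6.
  have key : M / k - B / A = ((M - B) + B / A * (A - k)) / k := by
    field_simp
    ring
  rw [key, abs_div, abs_of_pos hk0, div_le_iff₀ hk0]
  calc |M - B + B / A * (A - k)| ≤ |M - B| + |B / A * (A - k)| := abs_add_le _ _
    _ = |M - B| + B / A * |A - k| := by rw [abs_mul, abs_of_nonneg hq0]
    _ ≤ (δ * A + K) + 1 * (δ * A + K) := by gcongr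
    _ ≤ 6 * δ * k := by nlinarith

lemma tail_cdf_eq (ν : Measure ℝ) [IsProbabilityMeasure ν] (u : ℝ) :
    tail (cdf ν) u = ν.real (Set.Ioi u) := by
  rw [tail, cdf_eq_real, ← Set.compl_Iic, probReal_compl_eq_one_sub measurableSet_Iic]

/-- If p vanished from some point on, the ratio at x = 1 would be 0/0 = 0 there instead of tending
to 1. -/
lemma pos_of_regularlyVarying {p : ℝ → ℝ} {α : ℝ} (hp0 : ∀ u, 0 ≤ p u) (hanti : Antitone p)
    (hRV : RegularlyVarying p (-α)) (u : ℝ) : 0 < p u := by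
  by_contra! h
  have h0 : ∀ t, u ≤ t → p t = 0 := fun t ht => le_antisymm ((hanti ht).trans h) (hp0 t)
  have h1 := hRV 1 one_pos
  rw [Real.one_rpow] at h1
  have h2 : Tendsto (fun t => p (t * 1) / p t) atTop (𝓝 0) := by
    refine tendsto_const_nhds.congr' ?_
    filter_upwards [eventually_ge_atTop u] with t ht
    rw [h0 t ht, div_zero]
  exact one_ne_zero (tendsto_nhds_unique h1 h2)

/-- Consistency of the PLFit estimator for regularly varying continuous tails. -/
lemma tendstoInMeasure_plfit {Ω : Type*} [MeasurableSpace Ω] {P : Measure Ω}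
    [IsProbabilityMeasure P] {ν : Measure ℝ} [IsProbabilityMeasure ν] {X : ℕ → Ω → ℝ}
    (hX_meas : ∀ i, AEMeasurable (X i) P) (hX_law : ∀ i, P.map (X i) = ν)
    (hX_indep : iIndepFun X P) {α : ℝ} (hα : 0 < α) (hsupp : ∀ x < 1, cdf ν x = 0)
    (hRV : RegularlyVarying (tail (cdf ν)) (-α)) (hcont : Continuous (tail (cdf ν))) :
    TendstoInMeasure P (fun (n : ℕ) (ω : Ω) => plfit (fun i : Fin n => X i ω)) atTop
      (fun _ => α) := by
  have hpν := tail_cdf_eq ν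
  have hp01 : tail (cdf ν) 0 = 1 := by simp [tail, hsupp 0 one_pos]
  set p := tail (cdf ν) with hpdef
  have hanti : Antitone p := fun a b h => by
    rw [hpν, hpν]; exact measureReal_mono (Set.Ioi_subset_Ioi h)
  have hp := pos_of_regularlyVarying (fun u => by rw [hpν]; exact measureReal_nonneg) hanti hRV
  have hν : ∀ᵐ x ∂ν, 1 ≤ x := by
    have h1 : p 1 = 1 := by
      have hl : Tendsto p (𝓝[<] 1) (𝓝 (p 1)) := hcont.continuousAt.mono_left nhdsWithin_le_nhds
      refine tendsto_nhds_unique hl (tendsto_const_nhds.congr' ?_)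
      filter_upwards [self_mem_nhdsWithin] with u hu
      rw [hpdef, tail, hsupp u hu, sub_zero]
    rw [hpν] at h1
    have h2 : ν (Set.Ioi 1) = 1 := by
      rwa [measureReal_def, ENNReal.toReal_eq_one_iff] at h1
    filter_upwards [(mem_ae_iff_prob_eq_one measurableSet_Ioi).2 h2] with x hx
    exact (Set.mem_Ioi.1 hx).le
  have hX1 : ∀ᵐ ω ∂P, ∀ i, 1 ≤ X i ω := by
    rw [ae_all_iff]
    intro i
    rw [← hX_law i] at hν
    exact ae_of_ae_map (hX_meas i) hν
  rw [tendstoInMeasure_iff_norm]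
  intro ε hε
  rw [ENNReal.tendsto_nhds_zero]
  intro r hr
  obtain ⟨ρ, hρ0, hρr⟩ : ∃ ρ : ℝ, 0 < ρ ∧ ENNReal.ofReal ρ + ENNReal.ofReal ρ ≤ r := by
    obtain ⟨s, hs0, hsr⟩ := ENNReal.lt_iff_exists_nnreal_btwn.1 hr
    have hs : (0 : ℝ) < s := by exact_mod_cast hs0
    refine ⟨s / 2, by positivity, ?_⟩
    rw [← ENNReal.ofReal_add (by positivity) (by positivity), add_halves,
      ENNReal.ofReal_coe_nnreal]
    exact hsr.le
  obtain ⟨η, hη, hclose⟩ := exists_abs_sub_lt_of_close hp hcont hRV hε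
  set δ := min (η / 12) (1 / 4) with hδ
  have hδ0 : 0 < δ := by positivity
  have hδη : 6 * δ ≤ η / 2 := by linarith [min_le_left (η / 12) (1 / 4)]
  obtain ⟨K, hK, hdev⟩ := exists_measure_exceedances_deviation_le hX_meas hX_law hX_indep hcont
    hpν hp01 hδ0 hρ0
  -- The first bound is half of the tolerance η. The second, with 1 ≤ 2kD, forces k ≥ K/δ at the
  -- minimizer, which absorbs the additive error K.
  set η' := min (η / 2) (δ / (2 * K)) with hη'
  have hη'0 : 0 < η' := by positivity
  have hks := tendsto_measure_not_exists_ksDist_le hX_meas hX_law hX_indep hα hpν hν hp hcont hRV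
    hη'0
  filter_upwards [ENNReal.tendsto_nhds_zero.1 hks (ENNReal.ofReal ρ) (by simpa using hρ0),
    eventually_ge_atTop 2] with n hn hn2
  refine le_trans ?_ ((add_le_add hn (hdev n)).trans hρr)
  refine (measure_mono_ae ?_).trans (measure_union_le _ _)
  filter_upwards [hX1] with ω hω hbad
  by_contra hcon
  have hcon : ¬ (ω ∈ {ω | (∀ i, 1 ≤ X i ω) ∧
      ¬ ∃ k, 1 ≤ k ∧ k < n ∧ ksDist (fun i : Fin n => X i ω) k ≤ η'} ∪ {ω | ¬ ∀ u,
      |exceedances (fun i : Fin n => X i ω) u - n * p u| ≤ δ * (n * p u) + K}) := hcon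
  simp only [Set.mem_union, Set.mem_ofPred_eq, not_or, not_and, not_not] at hcon
  obtain ⟨⟨j, hj1, hjn, hj⟩, hdevω⟩ := hcon.imp_left fun h => h hω
  set x : Fin n → ℝ := fun i => X i ω
  have hx : ∀ i, 0 < x i := fun i => zero_lt_one.trans_le (hω i)
  obtain ⟨hk1, hkn, hmin⟩ := kappaStar_spec x hn2
  have hbad : ε ≤ ‖hillEstimator x (kappaStar x) - α‖ := hbad
  set k := kappaStar x
  have hD : ksDist x k ≤ η' := (hmin j hj1 hjn).trans hj
  have hk0 : (0 : ℝ) < k := by exact_mod_cast hk1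
  have hkK : K ≤ δ * k := by
    have h1 := one_le_two_mul_ksDist x hk1 hkn hx
    have h2 : ksDist x k ≤ δ / (2 * K) := hD.trans (min_le_right _ _)
    rw [le_div_iff₀ (by positivity)] at h2
    nlinarith
  have ht1 : 1 ≤ orderStat x (n - k) := by
    obtain ⟨i, hi⟩ := orderStat_mem x (j := n - k) (by omega) (by omega)
    rw [hi]
    exact hω i
  refine absurd hbad (not_le.2 ?_)
  rw [Real.norm_eq_abs]
  refine hclose _ _ ht1 fun y hy => ?_
  have h1 := abs_exceedances_div_sub_le x hx hp hanti hcont hδ0 (min_le_right _ _) hK hdevω hkn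
    hkK hy
  have h2 := (le_ksDist x hkn hx hy).trans (hD.trans (min_le_left _ _))
  rw [abs_le] at h1 h2 ⊢
  constructor <;> linarith [h1.1, h1.2, h2.1, h2.2]

end PLFit

theorem mainTheorem1 {Ω : Type*} [MeasurableSpace Ω] (P : Measure Ω) [IsProbabilityMeasure P]
    (ν : Measure ℝ) [IsProbabilityMeasure ν]
    (X : ℕ → Ω → ℝ)
    (hX_meas : ∀ i, AEMeasurable (X i) P)
    (hX_law : ∀ i, P.map (X i) = ν)
    (hX_indep : iIndepFun X P)
    (α : ℝ) (hα : 0 < α)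
    (hsupp : ∀ x < 1, cdf ν x = 0)
    (hRV : PLFit.RegularlyVarying (PLFit.tail (cdf ν)) (-α))
    (hcont : Continuous (PLFit.tail (cdf ν)))
    (hinv : ContinuousOn (PLFit.genInverse (cdf ν)) (Set.Ioo 0 1)) :
    TendstoInMeasure P (fun (n : ℕ) (ω : Ω) => PLFit.plfit (fun i : Fin n => X i ω)) atTop
      (fun _ => α) :=
  PLFit.tendstoInMeasure_plfit hX_meas hX_law hX_indep hα hsupp hRV hcont
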